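/- Let $n\ge 1$. For $S\subseteq[n]=\{1,\dots,n\}$ and $x\in\{\pm1\}^n$ write $x_S=\prod_{i\in S}x_i$. For $f\colon\{\pm1\}^n\to\{0,1\}$ let $\hat f(S)=\mathbb{E}_{x}[f(x)\,x_S]$, with $x$ uniform on $\{\pm1\}^n$, and for $\ell\in[n]$ let $$L_{1,\ell}(f)=\sum_{S\subseteq[n]:\,|S|=\ell}|\hat f(S)|.$$ A parity decision tree on $n$ variables is a rooted binary tree in which every internal node $v$ is labelled by a non-empty set $Q_v\subseteq[n]$ and has two outgoing edges, labelled $+1$ and $-1$, and every leaf is labelled by $0$ or $1$; it is required that no $Q_v$ is implied by the queries at the ancestors of $v$ (that is, the value of $x_{Q_v}$ is not determined by the values of $x_{Q_u}$ over the ancestors $u$ of $v$). On input $x$, one starts at the root and leaves each internal node $v$ that is reached along the edge labelled $x_{Q_v}$; the tree computes the function $f$ that maps $x$ to the label of the leaf reached. The size of the tree is its number of nodes (internal nodes and leaves). **Corollary.** There is a universal constant $C>0$ such that for every integer $n\ge2$, every real $s>1$ and every parity decision tree of size at most $s$ on $n$ variables, the function $f$ that it computes satisfies $$L_{1,\ell}(f)\le(\log_2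 s)^{\ell/2}\cdot\bigl(C\,\ell\,\log_2 n\bigr)^{1.5\,\ell}\qquad\text{for all }\ell\in[n].$$ -/

import Mathlib

namespace PDT

/-- The cube `{±1}ⁿ`; `ℤˣ` is exactly the two-element set `{1, -1}`. -/
abbrev Cube (n : ℕ) : Type := Fin n → ℤˣ

/-- The character `x_S = ∏_{i ∈ S} x_i ∈ {±1}`. -/
def chi {n : ℕ} (S : Finset (Fin n)) (x : Cube n) : ℤˣ := ∏ i ∈ S, x i

/-- The Fourier coefficient `f̂(S) = 𝔼_x [f(x) x_S]`, with `x` uniform on `{±1}ⁿ`. -/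
noncomputable def fourierCoeff {n : ℕ} (f : Cube n → ℝ) (S : Finset (Fin n)) : ℝ :=
  (∑ x : Cube n, f x * ((chi S x : ℤ) : ℝ)) / 2 ^ n

/-- `L_{1,ℓ}(f) = ∑_{|S| = ℓ} |f̂(S)|`. -/
noncomputable def levelL1 {n : ℕ} (ℓ : ℕ) (f : Cube n → ℝ) : ℝ :=
  ∑ S ∈ (Finset.univ : Finset (Fin n)).powersetCard ℓ, |fourierCoeff f S|

/-- Rooted binary trees whose internal nodes carry a set `Q ⊆ [n]`, with one outgoing edge
labelled `+1` (to `pos`) and one labelled `-1` (to `neg`), and whose leaves carry a bit. -/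
inductive QueryTree (n : ℕ) : Type
  | leaf (b : Bool) : QueryTree n
  | node (Q : Finset (Fin n)) (pos neg : QueryTree n) : QueryTree n

namespace QueryTree

/-- The label of the leaf reached by the computation path of `x`. -/
def eval {n : ℕ} : QueryTree n → Cube n → Bool
  | leaf b, _ => b
  | node Q pos neg, x => if chi Q x = 1 then pos.eval x else neg.eval x

/-- The number of nodes of the tree, internal nodes and leaves together. -/
def size {n : ℕ} : QueryTree n → ℕ
  | leaf _ => 1
  | node _ pos neg => 1 + pos.size + neg.size

end QueryTree

/-- The query `Q` is implied by the queries in `A`: the values of the parities in `A`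
determine the value of the parity on `Q`. -/
def Implied {n : ℕ} (A : Set (Finset (Fin n))) (Q : Finset (Fin n)) : Prop :=
  ∀ x y : Cube n, (∀ R ∈ A, chi R x = chi R y) → chi Q x = chi Q y

/-- Below ancestors that query the sets in `A`, every internal node of the tree queries a
non-empty set that is not implied by the queries at its ancestors. -/
def QueryTree.ValidBelow {n : ℕ} : Set (Finset (Fin n)) → QueryTree n → Prop
  | _, .leaf _ => True
  | A, .node Q pos neg =>
      Q.Nonempty ∧ ¬ Implied A Q ∧
        QueryTree.ValidBelow (insert Q A) pos ∧ QueryTree.ValidBelow (insert Q A) neg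

/-- A parity decision tree on `n` variables. -/
structure ParityDecisionTree (n : ℕ) where
  /-- the underlying labelled tree -/
  tree : QueryTree n
  /-- no query is empty or implied by the queries at the ancestors -/
  valid : tree.ValidBelow ∅

namespace ParityDecisionTree

/-- The function `{±1}ⁿ → {0,1} ⊆ ℝ` computed by the tree. -/
def toFun {n : ℕ} (T : ParityDecisionTree n) (x : Cube n) : ℝ :=
  if T.tree.eval x then 1 else 0

/-- The size of a parity decision tree is its number of nodes. -/
def size {n : ℕ} (T : ParityDecisionTree n) : ℕ := T.tree.size

end ParityDecisionTree

end PDT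

namespace PDT

open Finset
open scoped BigOperators

variable {n : ℕ}

/-! Choosing signs turns `levelL1` into the correlation of f with a polynomial p homogeneous of
degree ℓ, with coefficients in [-1, 1]. This correlation is followed down the tree.

A state (F, G) records the known coordinates and known parities. A query joins G; clean-up
(`exists_clean`) then trades parities for at most k = 2qℓ coordinates each, until every known parity
on at most k coordinates lies inside F. The conditional mean of μ^ℓ p is then `walk` with S = ∅. Its
2q-th power is at most `potential`, which has degree at most k and so sees newly known coordinates
as independent fair bits (`avg_of_clean`). By a two-point moment inequality each such bit costs a
factor γ (`half_potential_insert_le`). Since |F| + k|G| grows by at most k per query, each query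
costs at most γ^k.

The mean of f · μ^ℓ p is bounded by truncation at a threshold t β^depth. As β^(2q-1) ≥ γ^k, the
growing threshold pays for every query (`avg_val_mul_charSum_le`). For β = 2^(1/log₂ s) the mean of
β^depth is at most 2 (`avg_pow_depthAt_le`), so log s appears and not the depth. Taking q about log₂
n and 1/μ = 2q√(ℓ log₂ s) gives `levelL1_le`. -/

lemma chi_mul (S : Finset (Fin n)) (x y : Cube n) : chi S (x * y) = chi S x * chi S y :=
  Finset.prod_mul_distrib

lemma chi_one (S : Finset (Fin n)) : chi S (1 : Cube n) = 1 := by simp [chi]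

lemma chi_singleton (i : Fin n) (x : Cube n) : chi {i} x = x i := by simp [chi]

lemma chi_mul_self (S : Finset (Fin n)) (x : Cube n) : chi S x * chi S x = 1 :=
  Int.units_mul_self _

/-- The point of the cube whose only coordinate `-1` is the `r`-th. -/
def flip (r : Fin n) : Cube n := Pi.mulSingle r (-1)

lemma flip_same (r : Fin n) : flip r r = -1 := by simp [flip]

lemma flip_of_ne {r i : Fin n} (h : i ≠ r) : flip r i = 1 := by simp [flip, h]

lemma chi_flip_of_mem {r : Fin n} {S : Finset (Fin n)} (h : r ∈ S) : chi S (flip r) = -1 := by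
  unfold chi
  rw [Finset.prod_eq_single_of_mem r h fun i _ hi => flip_of_ne hi, flip_same]

/-- The character `x_S` with real values. -/
def chiR (S : Finset (Fin n)) (x : Cube n) : ℝ := ((chi S x : ℤ) : ℝ)

lemma chiR_mul (S : Finset (Fin n)) (x y : Cube n) : chiR S (x * y) = chiR S x * chiR S y := by
  simp [chiR, chi_mul]

lemma chiR_empty (x : Cube n) : chiR ∅ x = 1 := by simp [chiR, chi]

lemma chiR_insert {r : Fin n} {S : Finset (Fin n)} (h : r ∉ S) (x : Cube n) :
    chiR (insert r S) x = chiR {r} x * chiR S x := by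
  simp [chiR, chi, Finset.prod_insert h]

lemma chi_symmDiff (S T : Finset (Fin n)) (x : Cube n) :
    chi (symmDiff S T) x = chi S x * chi T x := by
  have h1 : chi S x = chi (S \ T) x * chi (S ∩ T) x := by
    unfold chi
    rw [← Finset.prod_union (Finset.disjoint_sdiff_inter S T), Finset.sdiff_union_inter]
  have h2 : chi T x = chi (T \ S) x * chi (S ∩ T) x := by
    unfold chi
    rw [Finset.inter_comm, ← Finset.prod_union (Finset.disjoint_sdiff_inter T S),
      Finset.sdiff_union_inter]
  have h3 : chi (symmDiff S T) x = chi (S \ T) x * chi (T \ S) x := by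
    unfold chi
    rw [← Finset.prod_union (by
      rw [Finset.disjoint_left]; intro i hi hj
      simp only [Finset.mem_sdiff] at hi hj
      exact hi.2 hj.1)]
    rfl
  rw [h1, h2, h3, mul_mul_mul_comm, chi_mul_self, mul_one]

lemma chiR_symmDiff (S T : Finset (Fin n)) (x : Cube n) :
    chiR (symmDiff S T) x = chiR S x * chiR T x := by
  simp [chiR, chi_symmDiff]

lemma chiR_sq (S : Finset (Fin n)) (x : Cube n) : chiR S x ^ 2 = 1 := by
  have := chi_mul_self S x
  rw [chiR, sq, ← Int.cast_mul, ← Units.val_mul, this]; simp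

lemma chiR_flip_of_mem {r : Fin n} {S : Finset (Fin n)} (h : r ∈ S) : chiR S (flip r) = -1 := by
  simp [chiR, chi_flip_of_mem h]

/-! ### Subgroups of directions and averages over their cosets -/

/-- The directions in which none of the parities in `A` changes. -/
def ann (A : Set (Finset (Fin n))) : Subgroup (Cube n) where
  carrier := {h | ∀ R ∈ A, chi R h = 1}
  mul_mem' {x y} hx hy R hR := by rw [chi_mul, hx R hR, hy R hR, one_mul]
  one_mem' R _ := chi_one R
  inv_mem' {x} hx R hR := by
    have h := chi_mul R x x⁻¹
    rw [mul_inv_cancel, chi_one, hx R hR, one_mul] at h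
    exact h.symm

lemma mem_ann {A : Set (Finset (Fin n))} {h : Cube n} : h ∈ ann A ↔ ∀ R ∈ A, chi R h = 1 :=
  Iff.rfl

lemma ann_anti {A B : Set (Finset (Fin n))} (h : A ⊆ B) : ann B ≤ ann A :=
  fun _ hx R hR => hx R (h hR)

open scoped Classical in
/-- The mean of `φ` over the coset `x H`. -/
noncomputable def avg (H : Subgroup (Cube n)) (φ : Cube n → ℝ) (x : Cube n) : ℝ :=
  𝔼 h : H, φ (x * h)

section avg

variable {H H' : Subgroup (Cube n)} {φ ψ : Cube n → ℝ} {x : Cube n}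

lemma avg_mono (h : ∀ k ∈ H, φ (x * k) ≤ ψ (x * k)) : avg H φ x ≤ avg H ψ x :=
  Finset.expect_le_expect fun k _ => h k k.2

lemma avg_congr (h : ∀ k ∈ H, φ (x * k) = ψ (x * k)) : avg H φ x = avg H ψ x :=
  Finset.expect_congr rfl fun k _ => h k k.2

lemma avg_const {c : ℝ} (h : ∀ k ∈ H, φ (x * k) = c) : avg H φ x = c := by
  classical
  exact (Finset.expect_congr rfl fun k _ => h _ k.2).trans (Fintype.expect_const c)

lemma avg_add : avg H (fun y => φ y + ψ y) x = avg H φ x + avg H ψ x :=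
  Finset.expect_add_distrib _ _ _

lemma avg_mul_left (c : ℝ) : avg H (fun y => c * φ y) x = c * avg H φ x :=
  (Finset.mul_expect _ _ _).symm

lemma avg_sum {ι : Type*} (s : Finset ι) (g : ι → Cube n → ℝ) :
    avg H (fun y => ∑ i ∈ s, g i y) x = ∑ i ∈ s, avg H (g i) x :=
  Finset.expect_sum_comm _ _ _

lemma avg_translate {k : Cube n} (hk : k ∈ H) : avg H (fun y => φ (y * k)) x = avg H φ x := by
  classical
  refine Fintype.expect_equiv (Equiv.mulRight (⟨k, hk⟩ : H)) _ _ fun h => ?_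
  simp [mul_assoc]

/-- Translation by `k` permutes the coset, so points may be averaged in pairs; fair bits enter the
proof through this. -/
lemma avg_pair {k : Cube n} (hk : k ∈ H) :
    avg H φ x = avg H (fun y => (1 / 2) * (φ y + φ (y * k))) x := by
  rw [avg_mul_left, avg_add, avg_translate hk]; ring

lemma avg_tower (h : H' ≤ H) : avg H (avg H' φ) x = avg H φ x := by
  classical
  refine (Finset.expect_comm _ _ _).trans
    ((Finset.expect_congr rfl fun k _ => ?_).trans (Fintype.expect_const (avg H φ x)))
  exact avg_translate (h k.2)

lemma avg_chiR_of_moved {S : Finset (Fin n)} {k : Cube n} (hk : k ∈ H) (hS : chi S k ≠ 1) :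
    avg H (chiR S) x = 0 := by
  have h1 : chiR S k = -1 := by
    rw [chiR, (Int.units_eq_one_or (chi S k)).resolve_left hS]; simp
  rw [avg_pair hk]
  exact avg_const fun y _ => by
    rw [chiR_mul _ (x * y) k, h1]; ring

lemma avg_chiR_of_fixed {S : Finset (Fin n)} (h : ∀ k ∈ H, chi S k = 1) :
    avg H (chiR S) x = chiR S x :=
  avg_const fun k hk => by rw [chiR_mul]; simp [chiR, h k hk]

end avg

lemma avg_top_one (φ : Cube n → ℝ) :
    avg (⊤ : Subgroup (Cube n)) φ 1 = (∑ x : Cube n, φ x) / 2 ^ n := by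
  classical
  have h : avg (⊤ : Subgroup (Cube n)) φ 1 = 𝔼 x : Cube n, φ x := by
    unfold avg
    exact Fintype.expect_equiv Subgroup.topEquiv.toEquiv _ _ fun h => by simp
  rw [h, Fintype.expect_eq_sum_div_card]
  simp

lemma ann_empty : ann (∅ : Set (Finset (Fin n))) = ⊤ := by
  ext; simp [mem_ann]

/-! ### States and clean-up -/

/-- The directions that change neither a coordinate in `F` nor a parity in `G`. -/
def dir (F : Finset (Fin n)) (G : Finset (Finset (Fin n))) : Subgroup (Cube n) :=
  ann ((fun i => {i}) '' (F : Set (Fin n)) ∪ (G : Set (Finset (Fin n))))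

lemma mem_dir {F : Finset (Fin n)} {G : Finset (Finset (Fin n))} {h : Cube n} :
    h ∈ dir F G ↔ (∀ i ∈ F, h i = 1) ∧ ∀ g ∈ G, chi g h = 1 := by
  simp [dir, mem_ann, or_imp, forall_and, chi_singleton]

lemma dir_empty : dir (∅ : Finset (Fin n)) ∅ = ⊤ := by
  ext; simp [mem_dir]

lemma chi_eq_one_of_subset {S F : Finset (Fin n)} (hS : S ⊆ F) {h : Cube n}
    (hh : ∀ i ∈ F, h i = 1) : chi S h = 1 :=
  Finset.prod_eq_one fun i hi => hh i (hS hi)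

lemma dir_insert_le (F : Finset (Fin n)) (G : Finset (Finset (Fin n))) (Q : Finset (Fin n)) :
    dir F (insert Q G) ≤ dir F G := fun h hh => by
  rw [mem_dir] at hh ⊢
  exact ⟨hh.1, fun g hg => hh.2 g (mem_insert_of_mem hg)⟩

lemma flip_mem_dir {F : Finset (Fin n)} {r : Fin n} (hr : r ∉ F) : flip r ∈ dir F ∅ := by
  rw [mem_dir]
  exact ⟨fun i hi => flip_of_ne fun e => hr (e ▸ hi), by simp⟩

/-- Every parity on at most `k` coordinates whose value is known involves only coordinates whose
values are known. -/
def Clean (k : ℕ) (F : Finset (Fin n)) (G : Finset (Finset (Fin n))) : Prop :=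
  ∀ V : Finset (Fin n), V.card ≤ k → (∀ h ∈ dir F G, chi V h = 1) → V ⊆ F

lemma clean_empty (k : ℕ) (F : Finset (Fin n)) : Clean k F ∅ := by
  intro V _ hV i hi
  by_contra hiF
  have := hV _ (flip_mem_dir hiF)
  rw [chi_flip_of_mem hi] at this
  exact absurd this (by decide)

/-- Steinitz exchange: some parity of `G` is needed to determine `V`, and it can be recovered from
`V` and the others. -/
lemma exists_exchange {F V : Finset (Fin n)} (hVF : ¬ V ⊆ F) (G : Finset (Finset (Fin n)))
    (hV : ∀ h ∈ dir F G, chi V h = 1) : ∃ g ∈ G, dir (F ∪ V) (G.erase g) ≤ dir F G := by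
  induction G using Finset.induction_on with
  | empty => exact absurd (clean_empty V.card F V le_rfl hV) hVF
  | insert g G hg ih =>
    by_cases hG : ∀ h ∈ dir F G, chi V h = 1
    · obtain ⟨g₀, hg₀, hle⟩ := ih hG
      have hne : g ≠ g₀ := fun e => hg (e ▸ hg₀)
      refine ⟨g₀, mem_insert_of_mem hg₀, fun h hh => ?_⟩
      rw [mem_dir] at hh
      have h1 : h ∈ dir F G := hle (mem_dir.2 ⟨hh.1, fun g' hg' =>
        hh.2 g' (erase_subset_erase _ (subset_insert g G) hg')⟩)
      rw [mem_dir] at h1 ⊢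
      refine ⟨h1.1, fun g' hg' => ?_⟩
      rcases mem_insert.1 hg' with rfl | h2
      · exact hh.2 _ (mem_erase.2 ⟨hne, mem_insert_self _ _⟩)
      · exact h1.2 _ h2
    · push Not at hG
      obtain ⟨h₁, h₁G, h₁V⟩ := hG
      refine ⟨g, mem_insert_self _ _, fun h hh => ?_⟩
      rw [erase_insert hg, mem_dir] at hh
      have hF : ∀ i ∈ F, h i = 1 := fun i hi => hh.1 i (mem_union_left _ hi)
      have hhV : chi V h = 1 := chi_eq_one_of_subset subset_union_right hh.1
      have key : ∀ y ∈ dir F G, chi g y = 1 → chi V y = 1 := fun y hy hgy => by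
        refine hV y (mem_dir.2 ⟨(mem_dir.1 hy).1, fun g' hg' => ?_⟩)
        rcases mem_insert.1 hg' with rfl | h2
        · exact hgy
        · exact (mem_dir.1 hy).2 _ h2
      have hhG : h ∈ dir F G := mem_dir.2 ⟨hF, hh.2⟩
      refine mem_dir.2 ⟨hF, fun g' hg' => ?_⟩
      rcases mem_insert.1 hg' with rfl | h2
      · by_contra hgh
        have e1 := (Int.units_eq_one_or (chi g' h)).resolve_left hgh
        have e2 : chi g' h₁ = -1 :=
          (Int.units_eq_one_or _).resolve_left fun e => h₁V (key _ h₁G e)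
        -- If `h` moved `g'`, then `h * h₁` would fix `g'` and still move `V`.
        have := key (h * h₁) (mul_mem hhG h₁G) (by rw [chi_mul, e1, e2]; decide)
        rw [chi_mul, hhV, one_mul] at this
        exact h₁V this
      · exact hh.2 _ h2

/-- Each exchange removes one parity and adds at most `k` coordinates, so the weighted count does
not grow and the process stops. -/
lemma exists_clean (k : ℕ) (F : Finset (Fin n)) (G : Finset (Finset (Fin n))) :
    ∃ F' G', F ⊆ F' ∧ Clean k F' G' ∧ dir F' G' ≤ dir F G ∧
      F'.card + k * G'.card ≤ F.card + k * G.card := by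
  induction hm : G.card generalizing F G with
  | zero =>
    obtain rfl := Finset.card_eq_zero.1 hm
    exact ⟨F, ∅, Subset.rfl, clean_empty k F, le_rfl, by simp⟩
  | succ m ih =>
    by_cases hc : Clean k F G
    · exact ⟨F, G, Subset.rfl, hc, le_rfl, by rw [hm]⟩
    · unfold Clean at hc
      push Not at hc
      obtain ⟨V, hk, hV, hVF⟩ := hc
      obtain ⟨g, hg, hle⟩ := exists_exchange hVF G hV
      obtain ⟨F', G', h1, h2, h3, h4⟩ := ih (F ∪ V) (G.erase g)
        (by rw [card_erase_of_mem hg, hm]; rfl)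
      refine ⟨F', G', subset_union_left.trans h1, h2, h3.trans hle, h4.trans ?_⟩
      have := card_union_le F V
      rw [Nat.mul_succ]
      omega

/-! ### Functions of low degree -/

/-- The functions of degree at most `d`. -/
def lowDegree (n d : ℕ) : Submodule ℝ (Cube n → ℝ) :=
  Submodule.span ℝ (chiR '' {V : Finset (Fin n) | V.card ≤ d})

lemma chiR_mem_lowDegree {V : Finset (Fin n)} {d : ℕ} (h : V.card ≤ d) :
    chiR V ∈ lowDegree n d := Submodule.subset_span ⟨V, h, rfl⟩

lemma lowDegree_mul {d e : ℕ} {φ ψ : Cube n → ℝ} (hφ : φ ∈ lowDegree n d)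
    (hψ : ψ ∈ lowDegree n e) : φ * ψ ∈ lowDegree n (d + e) := by
  have h : φ * ψ ∈ lowDegree n d * lowDegree n e := Submodule.mul_mem_mul hφ hψ
  rw [lowDegree, lowDegree, Submodule.span_mul_span] at h
  refine Submodule.span_mono ?_ h
  rintro _ ⟨_, ⟨S, hS, rfl⟩, _, ⟨T, hT, rfl⟩, rfl⟩
  refine ⟨symmDiff S T, ?_, funext fun x => chiR_symmDiff S T x⟩
  have h1 : (symmDiff S T).card ≤ (S ∪ T).card := card_le_card (fun i hi => by
    rw [Finset.mem_symmDiff] at hi; rw [mem_union]; tauto)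
  exact h1.trans ((card_union_le _ _).trans (add_le_add hS hT))

lemma lowDegree_pow {d : ℕ} {φ : Cube n → ℝ} (hφ : φ ∈ lowDegree n d) (p : ℕ) :
    φ ^ p ∈ lowDegree n (p * d) := by
  induction p with
  | zero =>
    have : φ ^ 0 = chiR ∅ := funext fun x => by simp [chiR_empty]
    rw [this]
    exact chiR_mem_lowDegree (by simp)
  | succ p ih => rw [pow_succ, Nat.succ_mul]; exact lowDegree_mul ih hφ

lemma avg_chiR_of_clean {k : ℕ} {F : Finset (Fin n)} {G : Finset (Finset (Fin n))}
    (hc : Clean k F G) {V : Finset (Fin n)} (hV : V.card ≤ k) (x : Cube n) :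
    avg (dir F G) (chiR V) x = if V ⊆ F then chiR V x else 0 := by
  split_ifs with h
  · exact avg_chiR_of_fixed fun k hk => chi_eq_one_of_subset h (mem_dir.1 hk).1
  · have : ¬ ∀ y ∈ dir F G, chi V y = 1 := fun h' => h (hc V hV h')
    push Not at this
    obtain ⟨y, hy, hy'⟩ := this
    exact avg_chiR_of_moved hy hy'

/-- Below a clean state the known parities cannot be noticed by functions of low degree. -/
lemma avg_of_clean {k : ℕ} {F : Finset (Fin n)} {G : Finset (Finset (Fin n))}
    (hc : Clean k F G) {φ : Cube n → ℝ} (hφ : φ ∈ lowDegree n k) (x : Cube n) :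
    avg (dir F G) φ x = avg (dir F ∅) φ x := by
  induction hφ using Submodule.span_induction with
  | mem φ h =>
    obtain ⟨V, hV, rfl⟩ := h
    rw [avg_chiR_of_clean hc hV, avg_chiR_of_clean (clean_empty k F) hV]
  | zero => simp [avg]
  | add φ ψ _ _ h1 h2 =>
    exact (avg_add (φ := φ) (ψ := ψ)).trans (by rw [h1, h2]; exact avg_add.symm)
  | smul c φ _ h =>
    exact (avg_mul_left (φ := φ) c).trans (by rw [h]; exact (avg_mul_left c).symm)

/-! ### Walks and the growth of the potential -/

/-- The normalised walk in the direction `S`, for the level-`ℓ` coefficients `a`. -/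
noncomputable def walk (a : Finset (Fin n) → ℝ) (μ : ℝ) (F S : Finset (Fin n)) (x : Cube n) : ℝ :=
  ∑ U ∈ (F \ S).powerset, a (U ∪ S) * μ ^ U.card * chiR U x

/-- The potential: the sum of the `p`-th powers of the walks in all directions. -/
noncomputable def potential (a : Finset (Fin n) → ℝ) (μ : ℝ) (p : ℕ) (F : Finset (Fin n))
    (x : Cube n) : ℝ :=
  ∑ S : Finset (Fin n), walk a μ F S x ^ p

lemma walk_mem_lowDegree {a : Finset (Fin n) → ℝ} {ℓ : ℕ} (ha : ∀ V, ℓ < V.card → a V = 0)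
    (μ : ℝ) (F S : Finset (Fin n)) : walk a μ F S ∈ lowDegree n ℓ := by
  have : walk a μ F S = ∑ U ∈ (F \ S).powerset, (a (U ∪ S) * μ ^ U.card) • chiR U := by
    ext x; simp [walk]
  rw [this]
  refine Submodule.sum_mem _ fun U _ => ?_
  by_cases hU : U.card ≤ ℓ
  · exact Submodule.smul_mem _ _ (chiR_mem_lowDegree hU)
  · rw [ha _ (lt_of_lt_of_le (not_le.1 hU) (card_le_card subset_union_left))]
    simp

lemma potential_mem_lowDegree {a : Finset (Fin n) → ℝ} {ℓ : ℕ} (ha : ∀ V, ℓ < V.card → a V = 0)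
    (μ : ℝ) (p : ℕ) (F : Finset (Fin n)) : potential a μ p F ∈ lowDegree n (p * ℓ) := by
  have : potential a μ p F = ∑ S, walk a μ F S ^ p := by ext x; simp [potential]
  rw [this]
  exact Submodule.sum_mem _ fun S _ => lowDegree_pow (walk_mem_lowDegree ha μ F S) p

lemma chiR_congr {S : Finset (Fin n)} {x y : Cube n} (h : ∀ i ∈ S, x i = y i) :
    chiR S x = chiR S y := by
  simp only [chiR, chi]
  rw [Finset.prod_congr rfl h]

lemma walk_congr (a : Finset (Fin n) → ℝ) (μ : ℝ) {F : Finset (Fin n)} (S : Finset (Fin n))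
    {x y : Cube n} (h : ∀ i ∈ F, x i = y i) : walk a μ F S x = walk a μ F S y :=
  Finset.sum_congr rfl fun U hU => by
    rw [chiR_congr fun i hi => h i (mem_sdiff.1 (mem_powerset.1 hU hi)).1]

lemma potential_congr (a : Finset (Fin n) → ℝ) (μ : ℝ) (p : ℕ) {F : Finset (Fin n)}
    {x y : Cube n} (h : ∀ i ∈ F, x i = y i) : potential a μ p F x = potential a μ p F y :=
  Finset.sum_congr rfl fun S _ => by rw [walk_congr a μ S h]

lemma walk_insert_of_mem (a : Finset (Fin n) → ℝ) (μ : ℝ) {F S : Finset (Fin n)} {r : Fin n}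
    (hr : r ∈ S) (x : Cube n) : walk a μ (insert r F) S x = walk a μ F S x := by
  rw [walk, insert_sdiff_of_mem _ hr, walk]

/-- The sets U containing `r` give the derivative in direction `r`. This is why the potential has to
include all directions. -/
lemma walk_insert_of_notMem (a : Finset (Fin n) → ℝ) (μ : ℝ) {F S : Finset (Fin n)} {r : Fin n}
    (hF : r ∉ F) (hS : r ∉ S) (x : Cube n) :
    walk a μ (insert r F) S x =
      walk a μ F S x + chiR {r} x * (μ * walk a μ F (insert r S) x) := by
  have hr : r ∉ F \ S := fun h => hF (mem_sdiff.1 h).1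
  have hs : F \ insert r S = F \ S := by
    rw [sdiff_insert, erase_eq_of_notMem hr]
  rw [walk, insert_sdiff_of_notMem _ hS, sum_powerset_insert hr, walk, walk, hs, mul_sum, mul_sum]
  congr 1
  refine sum_congr rfl fun U hU => ?_
  have hrU : r ∉ U := fun h => hr (mem_powerset.1 hU h)
  rw [chiR_insert hrU, card_insert_of_notMem hrU, insert_union, ← union_insert]
  ring

lemma choose_two_mul_le (q j : ℕ) :
    (2 * q).choose (2 * j) ≤ q.choose j * (2 * q - 1) ^ j := by
  induction j with
  | zero => simp
  | succ j ih =>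
    rcases le_or_gt q j with hq | hq
    · rw [Nat.choose_eq_zero_of_lt (by omega)]; exact Nat.zero_le _
    have e1 := Nat.choose_succ_right_eq (2 * q) (2 * j)
    have e2 := Nat.choose_succ_right_eq (2 * q) (2 * j + 1)
    have e3 := Nat.choose_succ_right_eq q j
    -- Ratios of consecutive terms are compared: (2m+1)(2m+2) / ((2j+1)(2j+2)) against W(m+1)/(j+1),
    -- where W = 2q - 1.
    obtain ⟨m, rfl⟩ : ∃ m, q = j + 1 + m := ⟨q - j - 1, by omega⟩
    have s1 : 2 * (j + 1 + m) - 2 * j = 2 * (m + 1) := by omega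
    have s2 : 2 * (j + 1 + m) - (2 * j + 1) = 2 * m + 1 := by omega
    have s3 : j + 1 + m - j = m + 1 := by omega
    have s4 : 2 * (j + 1 + m) - 1 = 2 * j + 2 * m + 1 := by omega
    rw [s1] at e1
    rw [s2] at e2
    rw [s3] at e3
    rw [s4] at ih ⊢
    set A := (2 * (j + 1 + m)).choose (2 * j)
    set B := (2 * (j + 1 + m)).choose (2 * j + 1)
    set C := (2 * (j + 1 + m)).choose (2 * j + 1 + 1)
    set D := (j + 1 + m).choose j
    set E := (j + 1 + m).choose (j + 1)
    set W := 2 * j + 2 * m + 1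
    change C ≤ E * W ^ (j + 1)
    have hpos : 0 < (2 * j + 1) * (2 * (j + 1)) := by positivity
    refine Nat.le_of_mul_le_mul_left ?_ hpos
    calc (2 * j + 1) * (2 * (j + 1)) * C = (2 * j + 1) * (C * (2 * j + 1 + 1)) := by ring
      _ = (2 * m + 1) * (B * (2 * j + 1)) := by rw [e2]; ring
      _ = (2 * m + 1) * (2 * (m + 1)) * A := by rw [e1]; ring
      _ ≤ W * (2 * (m + 1)) * (D * W ^ j) := by
        gcongr
        omega
      _ = 2 * (D * (m + 1)) * W ^ (j + 1) := by ring
      _ = 1 * (2 * (j + 1)) * (E * W ^ (j + 1)) := by rw [← e3]; ring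
      _ ≤ (2 * j + 1) * (2 * (j + 1)) * (E * W ^ (j + 1)) := by
        gcongr
        omega

lemma sum_range_two_mul_add_one (g : ℕ → ℝ) (q : ℕ) :
    ∑ i ∈ range (2 * q + 1), g i =
      ∑ j ∈ range (q + 1), g (2 * j) + ∑ j ∈ range q, g (2 * j + 1) := by
  induction q with
  | zero => simp
  | succ q ih =>
    rw [show 2 * (q + 1) + 1 = 2 * q + 1 + 1 + 1 by ring, sum_range_succ, sum_range_succ, ih,
      sum_range_succ _ (q + 1), sum_range_succ (fun j => g (2 * j + 1)) q]
    rw [show 2 * (q + 1) = 2 * q + 1 + 1 by ring]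
    ring

/-- The two-point moment inequality. -/
lemma half_add_pow_le (q : ℕ) (hq : 1 ≤ q) (a b : ℝ) :
    (1 / 2) * ((a + b) ^ (2 * q) + (a + -b) ^ (2 * q)) ≤
      (a ^ 2 + (2 * q - 1) * b ^ 2) ^ q := by
  have h1 : (1 / 2) * ((a + b) ^ (2 * q) + (a + -b) ^ (2 * q)) =
      ∑ j ∈ range (q + 1), (b ^ 2) ^ j * (a ^ 2) ^ (q - j) * (2 * q).choose (2 * j) := by
    rw [add_comm a b, add_comm a (-b), add_pow, add_pow, sum_range_two_mul_add_one,
      sum_range_two_mul_add_one]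
    have e0 : ∑ j ∈ range (q + 1), b ^ (2 * j) * a ^ (2 * q - 2 * j) * ((2 * q).choose (2 * j))
        = ∑ j ∈ range (q + 1), (b ^ 2) ^ j * (a ^ 2) ^ (q - j) * (2 * q).choose (2 * j) :=
      sum_congr rfl fun j _ => by rw [← Nat.mul_sub, pow_mul, pow_mul]
    have e1 : ∑ j ∈ range (q + 1), (-b) ^ (2 * j) * a ^ (2 * q - 2 * j) *
        ((2 * q).choose (2 * j)) =
        ∑ j ∈ range (q + 1), (b ^ 2) ^ j * (a ^ 2) ^ (q - j) * (2 * q).choose (2 * j) :=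
      sum_congr rfl fun j _ => by rw [← Nat.mul_sub, pow_mul, pow_mul, neg_sq]
    have e2 : ∑ j ∈ range q, (-b) ^ (2 * j + 1) * a ^ (2 * q - (2 * j + 1)) *
        ((2 * q).choose (2 * j + 1)) = - ∑ j ∈ range q, b ^ (2 * j + 1) *
          a ^ (2 * q - (2 * j + 1)) * ((2 * q).choose (2 * j + 1)) := by
      rw [← sum_neg_distrib]
      refine sum_congr rfl fun j _ => ?_
      rw [Odd.neg_pow ⟨j, rfl⟩]; ring
    rw [e0, e1, e2]; ring
  have hq' : ((2 * q - 1 : ℕ) : ℝ) = 2 * q - 1 := by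
    rw [Nat.cast_sub (by omega)]; push_cast; ring
  rw [h1, add_comm (a ^ 2), add_pow]
  refine sum_le_sum fun j _ => ?_
  have h2 : (((2 * q).choose (2 * j) : ℕ) : ℝ) ≤ (q.choose j : ℝ) * (2 * q - 1) ^ j := by
    rw [← hq']; exact_mod_cast choose_two_mul_le q j
  calc _ ≤ (b ^ 2) ^ j * (a ^ 2) ^ (q - j) * ((q.choose j : ℝ) * (2 * q - 1) ^ j) := by gcongr
    _ = _ := by rw [mul_pow]; ring

/-- Jensen for the power function with weights 1/(1+θ) and θ/(1+θ). -/
lemma add_mul_pow_le {θ : ℝ} (hθ : 0 ≤ θ) (q : ℕ) {u v : ℝ} (hu : 0 ≤ u) (hv : 0 ≤ v) :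
    (u + θ * v) ^ (q + 1) ≤ (1 + θ) ^ q * (u ^ (q + 1) + θ * v ^ (q + 1)) := by
  have hpos : 0 < 1 + θ := by positivity
  have h := (convexOn_pow (𝕜 := ℝ) (q + 1)).2 (Set.mem_Ici.2 hu) (Set.mem_Ici.2 hv)
    (by positivity : 0 ≤ 1 / (1 + θ)) (by positivity : 0 ≤ θ / (1 + θ)) (by field_simp)
  simp only [smul_eq_mul] at h
  have e1 : 1 / (1 + θ) * u + θ / (1 + θ) * v = (u + θ * v) / (1 + θ) := by field_simp
  have e2 : 1 / (1 + θ) * u ^ (q + 1) + θ / (1 + θ) * v ^ (q + 1) =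
      (u ^ (q + 1) + θ * v ^ (q + 1)) / (1 + θ) := by field_simp
  rw [e1, e2, div_pow, div_le_div_iff₀ (by positivity) hpos] at h
  have h3 : (u + θ * v) ^ (q + 1) * (1 + θ) ≤
      (1 + θ) ^ q * (u ^ (q + 1) + θ * v ^ (q + 1)) * (1 + θ) := by
    refine h.trans_eq ?_; ring
  exact le_of_mul_le_mul_right h3 hpos

lemma potential_nonneg (a : Finset (Fin n) → ℝ) (μ : ℝ) (q : ℕ) (F : Finset (Fin n))
    (x : Cube n) : 0 ≤ potential a μ (2 * q) F x :=
  sum_nonneg fun _ _ => (even_two_mul q).pow_nonneg _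

lemma walk_pow_le_potential (a : Finset (Fin n) → ℝ) (μ : ℝ) (q : ℕ) (F S : Finset (Fin n))
    (x : Cube n) : walk a μ F S x ^ (2 * q) ≤ potential a μ (2 * q) F x :=
  single_le_sum (f := fun S => walk a μ F S x ^ (2 * q))
    (fun _ _ => (even_two_mul q).pow_nonneg _) (mem_univ S)

lemma sum_finset_split (r : Fin n) (g : Finset (Fin n) → ℝ) :
    ∑ S, g S = ∑ S ∈ (univ.erase r).powerset, (g S + g (insert r S)) := by
  rw [sum_add_distrib, ← sum_powerset_insert (notMem_erase r univ), insert_erase (mem_univ r),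
    powerset_univ]

/-- One fresh uniform bit multiplies the potential by at most `(1 + (2q - 1) μ²)^q` on average. -/
lemma half_potential_insert_le (a : Finset (Fin n) → ℝ) (μ : ℝ) {q : ℕ} (hq : 1 ≤ q)
    {F : Finset (Fin n)} {r : Fin n} (hr : r ∉ F) (x : Cube n) :
    (1 / 2) * (potential a μ (2 * q) (insert r F) x +
      potential a μ (2 * q) (insert r F) (x * flip r)) ≤
      (1 + (2 * q - 1) * μ ^ 2) ^ q * potential a μ (2 * q) F x := by
  obtain ⟨q, rfl⟩ : ∃ m, q = m + 1 := ⟨q - 1, by omega⟩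
  set θ : ℝ := (2 * ((q + 1 : ℕ) : ℝ) - 1) * μ ^ 2 with hθ
  have hθ0 : 0 ≤ θ := by
    refine mul_nonneg ?_ (sq_nonneg _)
    push_cast
    have : (0 : ℝ) ≤ q := Nat.cast_nonneg q
    linarith
  have hF : ∀ S, walk a μ F S (x * flip r) = walk a μ F S x := fun S =>
    walk_congr a μ S fun i hi => by
      rw [Pi.mul_apply, flip_of_ne (ne_of_mem_of_not_mem hi hr), mul_one]
  unfold potential
  -- Directions are paired as `S` and `insert r S` with `r ∉ S`: only the first walk changes, by ±μ
  -- times the second.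
  rw [← sum_add_distrib, mul_sum, sum_finset_split r, sum_finset_split r
    (fun S => walk a μ F S x ^ (2 * (q + 1))), mul_sum]
  refine sum_le_sum fun S hS => ?_
  have hrS : r ∉ S := fun h => notMem_erase r univ (mem_powerset.1 hS h)
  rw [walk_insert_of_mem a μ (mem_insert_self r S), walk_insert_of_mem a μ (mem_insert_self r S),
    walk_insert_of_notMem a μ hr hrS, walk_insert_of_notMem a μ hr hrS, hF, hF, chiR_mul,
    chiR_flip_of_mem (mem_singleton_self r)]
  set w := walk a μ F S x
  set v := walk a μ F (insert r S) x
  set c := chiR {r} x with hc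
  have hc2 : c ^ 2 = 1 := chiR_sq _ _
  have h1 := half_add_pow_le (q + 1) (by omega) w (c * (μ * v))
  have e1 : w ^ 2 + (2 * ((q + 1 : ℕ) : ℝ) - 1) * (c * (μ * v)) ^ 2 = w ^ 2 + θ * v ^ 2 := by
    rw [hθ, mul_pow, hc2]; ring
  rw [e1] at h1
  have h2 := add_mul_pow_le hθ0 q (sq_nonneg w) (sq_nonneg v)
  rw [← pow_mul, ← pow_mul] at h2
  have hv : 0 ≤ v ^ (2 * (q + 1)) := (even_two_mul _).pow_nonneg _
  have h3 : 1 ≤ (1 + θ) ^ q := one_le_pow₀ (by linarith)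
  have e2 : c * -1 * (μ * v) = -(c * (μ * v)) := by ring
  rw [e2]
  have h4 : v ^ (2 * (q + 1)) ≤ (1 + θ) ^ q * v ^ (2 * (q + 1)) := le_mul_of_one_le_left hv h3
  calc _ = (1 / 2) * ((w + c * (μ * v)) ^ (2 * (q + 1)) + (w + -(c * (μ * v))) ^ (2 * (q + 1)))
        + v ^ (2 * (q + 1)) := by ring
    _ ≤ (1 + θ) ^ q * (w ^ (2 * (q + 1)) + θ * v ^ (2 * (q + 1))) +
        (1 + θ) ^ q * v ^ (2 * (q + 1)) := add_le_add (h1.trans h2) h4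
    _ = (1 + θ) ^ (q + 1) * (w ^ (2 * (q + 1)) + v ^ (2 * (q + 1))) -
        (1 + θ) ^ q * (θ * w ^ (2 * (q + 1))) := by ring
    _ ≤ _ := sub_le_self _ (by
        have := (even_two_mul (q + 1)).pow_nonneg w
        positivity)

lemma avg_potential_free_le (a : Finset (Fin n) → ℝ) (μ : ℝ) {q : ℕ} (hq : 1 ≤ q)
    (F D : Finset (Fin n)) (hD : Disjoint F D) (x : Cube n) :
    avg (dir F ∅) (potential a μ (2 * q) (F ∪ D)) x ≤
      ((1 + (2 * q - 1) * μ ^ 2) ^ q) ^ D.card * potential a μ (2 * q) F x := by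
  induction D using Finset.induction_on with
  | empty =>
    rw [union_empty, card_empty, pow_zero, one_mul]
    refine (avg_const fun k hk => potential_congr a μ _ fun i hi => ?_).le
    rw [Pi.mul_apply, (mem_dir.1 hk).1 i hi, mul_one]
  | insert r D hr ih =>
    rw [disjoint_insert_right] at hD
    have hq' : (1 : ℝ) ≤ q := by exact_mod_cast hq
    have hγ : 0 ≤ (1 + (2 * q - 1) * μ ^ 2) ^ q := by
      have : 0 ≤ (2 * q - 1) * μ ^ 2 := mul_nonneg (by linarith) (sq_nonneg _)
      positivity
    have hFD : r ∉ F ∪ D := by simp [hD.1, hr]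
    rw [union_insert, avg_pair (flip_mem_dir hD.1), card_insert_of_notMem hr, pow_succ']
    calc _ ≤ avg (dir F ∅) (fun y => (1 + (2 * q - 1) * μ ^ 2) ^ q *
          potential a μ (2 * q) (F ∪ D) y) x :=
          avg_mono fun k _ => half_potential_insert_le a μ hq hFD _
      _ ≤ _ := by
          rw [avg_mul_left, mul_assoc]
          exact mul_le_mul_of_nonneg_left (ih hD.2) hγ

lemma avg_potential_le {a : Finset (Fin n) → ℝ} {ℓ : ℕ} (ha : ∀ V, ℓ < V.card → a V = 0)
    (μ : ℝ) {q : ℕ} (hq : 1 ≤ q) {F F' : Finset (Fin n)} {G : Finset (Finset (Fin n))}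
    (hc : Clean (2 * q * ℓ) F G) (hF : F ⊆ F') (x : Cube n) :
    avg (dir F G) (potential a μ (2 * q) F') x ≤
      ((1 + (2 * q - 1) * μ ^ 2) ^ q) ^ (F'.card - F.card) * potential a μ (2 * q) F x := by
  rw [avg_of_clean hc (potential_mem_lowDegree ha μ _ _)]
  have := avg_potential_free_le a μ hq F (F' \ F) disjoint_sdiff x
  rwa [union_sdiff_of_subset hF, card_sdiff_of_subset hF] at this

/-- The polynomial with coefficients `a`. -/
noncomputable def charSum (a : Finset (Fin n) → ℝ) (x : Cube n) : ℝ := ∑ S, a S * chiR S x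

/-- Cleanness kills the characters not supported in `F`; the survivors have degree ℓ, so μ^|U| is
the constant μ^ℓ. -/
lemma avg_charSum {a : Finset (Fin n) → ℝ} {ℓ k : ℕ} (ha : ∀ V, V.card ≠ ℓ → a V = 0)
    (hℓ : ℓ ≤ k) (μ : ℝ) {F : Finset (Fin n)} {G : Finset (Finset (Fin n))} (hc : Clean k F G)
    (x : Cube n) : avg (dir F G) (fun y => μ ^ ℓ * charSum a y) x = walk a μ F ∅ x := by
  have h1 : avg (dir F G) (fun y => μ ^ ℓ * charSum a y) x =
      ∑ S, μ ^ ℓ * (a S * avg (dir F G) (chiR S) x) := by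
    rw [avg_mul_left, ← mul_sum]
    congr 1
    exact (avg_sum _ _).trans (sum_congr rfl fun S _ => avg_mul_left _)
  rw [h1, walk, sdiff_empty]
  symm
  refine (sum_congr rfl fun U hU => ?_).trans (sum_subset (subset_univ F.powerset) fun S _ hS => ?_)
  · rw [union_empty]
    by_cases hUc : U.card = ℓ
    · rw [avg_chiR_of_clean hc (hUc.trans_le hℓ), if_pos (mem_powerset.1 hU), hUc]; ring
    · rw [ha U hUc]; simp
  · by_cases hSc : S.card = ℓ
    · rw [avg_chiR_of_clean hc (hSc.trans_le hℓ), if_neg fun h => hS (mem_powerset.2 h)]; simp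
    · rw [ha S hSc]; simp

/-- Truncation: above the threshold `t`, |w|/t is at least 1 and is bounded by its 2q-th power. -/
lemma abs_le_add_pow {t : ℝ} (ht : 0 < t) {q : ℕ} (hq : 1 ≤ q) (w : ℝ) :
    |w| ≤ t + t / t ^ (2 * q) * w ^ (2 * q) := by
  rcases le_or_gt |w| t with h | h
  · have : 0 ≤ t / t ^ (2 * q) * w ^ (2 * q) :=
      mul_nonneg (by positivity) ((even_two_mul q).pow_nonneg _)
    linarith
  · have h1 : 1 ≤ |w| / t := (one_le_div ht).2 h.le
    have h2 : |w| / t ≤ (|w| / t) ^ (2 * q) := le_self_pow₀ h1 (by omega)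
    have h3 : |w| ≤ t * (|w| / t) ^ (2 * q) := by
      rwa [div_le_iff₀' ht] at h2
    rw [div_pow, (even_two_mul q).pow_abs] at h3
    calc |w| ≤ t * (w ^ (2 * q) / t ^ (2 * q)) := h3
      _ = t / t ^ (2 * q) * w ^ (2 * q) := by ring
      _ ≤ _ := le_add_of_nonneg_left ht.le

/-! ### Induction on the tree -/

namespace QueryTree

/-- The real-valued function computed by the tree. -/
noncomputable def val (T : QueryTree n) (x : Cube n) : ℝ := if T.eval x then 1 else 0

/-- The number of queries made on input `x`. -/
def depthAt : QueryTree n → Cube n → ℕ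
  | leaf _, _ => 0
  | node Q pos neg, x => (if chi Q x = 1 then pos.depthAt x else neg.depthAt x) + 1

lemma val_node (Q : Finset (Fin n)) (pos neg : QueryTree n) (x : Cube n) :
    (node Q pos neg).val x = if chi Q x = 1 then pos.val x else neg.val x := by
  unfold val
  rw [eval]
  split_ifs <;> rfl

lemma size_pos (T : QueryTree n) : 1 ≤ T.size := by
  cases T <;> simp [size]; omega

end QueryTree

lemma chi_mul_of_mem_dir_insert {F : Finset (Fin n)} {G : Finset (Finset (Fin n))}
    {Q : Finset (Fin n)} {h : Cube n} (hh : h ∈ dir F (insert Q G)) (x : Cube n) :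
    chi Q (x * h) = chi Q x := by
  rw [chi_mul, (mem_dir.1 hh).2 Q (mem_insert_self _ _), mul_one]

/-- The correlation of the tree with a level-`ℓ` polynomial, below a clean state. -/
theorem avg_val_mul_charSum_le {a : Finset (Fin n) → ℝ} {ℓ : ℕ}
    (ha : ∀ V, V.card ≠ ℓ → a V = 0) {μ : ℝ} {q : ℕ} (hq : 1 ≤ q) {β γ : ℝ} (hβ : 0 < β)
    (hγ : γ = (1 + (2 * q - 1) * μ ^ 2) ^ q) (hβγ : γ ^ (2 * q * ℓ) ≤ β ^ (2 * q - 1))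
    (T : QueryTree n) (F : Finset (Fin n)) (G : Finset (Finset (Fin n)))
    (hc : Clean (2 * q * ℓ) F G) {t : ℝ} (ht : 0 < t) (x : Cube n) :
    avg (dir F G) (fun y => T.val y * (μ ^ ℓ * charSum a y)) x ≤
      t * avg (dir F G) (fun y => β ^ T.depthAt y) x +
        t / t ^ (2 * q) * (γ ^ (2 * q * ℓ * G.card) * potential a μ (2 * q) F x) := by
  have hq' : (1 : ℝ) ≤ q := by exact_mod_cast hq
  have hγ1 : 1 ≤ γ := by
    rw [hγ]
    refine one_le_pow₀ (le_add_of_nonneg_right (mul_nonneg (by linarith) (sq_nonneg _)))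
  induction T generalizing F G t x with
  | leaf b =>
    have h1 : avg (dir F G) (fun y => (QueryTree.leaf b).val y * (μ ^ ℓ * charSum a y)) x ≤
        |walk a μ F ∅ x| := by
      have h0 : avg (dir F G) (fun y => (QueryTree.leaf b).val y * (μ ^ ℓ * charSum a y)) x =
          (if b then 1 else 0) * walk a μ F ∅ x := by
        rw [← avg_charSum ha (Nat.le_mul_of_pos_left ℓ (by omega)) μ hc x, ← avg_mul_left]
        rfl
      rw [h0]
      cases b
      · simp
      · simpa using le_abs_self _
    have h2 : avg (dir F G) (fun y => β ^ (QueryTree.leaf b).depthAt y) x = 1 :=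
      avg_const fun _ _ => by simp [QueryTree.depthAt]
    rw [h2, mul_one]
    refine h1.trans ((abs_le_add_pow ht hq _).trans ?_)
    gcongr
    exact (walk_pow_le_potential a μ q F ∅ x).trans
      (le_mul_of_one_le_left (potential_nonneg a μ q F x) (one_le_pow₀ hγ1))
  | node Q pos neg ihp ihn =>
    obtain ⟨F', G', hFF', hc', hdir, hcard⟩ := exists_clean (2 * q * ℓ) F (insert Q G)
    have hle : dir F' G' ≤ dir F G := hdir.trans (dir_insert_le F G Q)
    have hchild : ∀ z : Cube n,
        avg (dir F' G') (fun y => (QueryTree.node Q pos neg).val y * (μ ^ ℓ * charSum a y)) z ≤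
          t * avg (dir F' G') (fun y => β ^ (QueryTree.node Q pos neg).depthAt y) z +
            t * β / (t * β) ^ (2 * q) * γ ^ (2 * q * ℓ * G'.card) *
              potential a μ (2 * q) F' z := by
      intro z
      have aux : ∀ T' : QueryTree n,
          (∀ y, chi Q y = chi Q z → (QueryTree.node Q pos neg).val y = T'.val y) →
          (∀ y, chi Q y = chi Q z →
            (QueryTree.node Q pos neg).depthAt y = T'.depthAt y + 1) →
          avg (dir F' G') (fun y => T'.val y * (μ ^ ℓ * charSum a y)) z ≤
            t * β * avg (dir F' G') (fun y => β ^ T'.depthAt y) z +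
              t * β / (t * β) ^ (2 * q) * (γ ^ (2 * q * ℓ * G'.card) *
                potential a μ (2 * q) F' z) →
          avg (dir F' G') (fun y => (QueryTree.node Q pos neg).val y * (μ ^ ℓ * charSum a y)) z ≤
            t * avg (dir F' G') (fun y => β ^ (QueryTree.node Q pos neg).depthAt y) z +
              t * β / (t * β) ^ (2 * q) * γ ^ (2 * q * ℓ * G'.card) *
                potential a μ (2 * q) F' z := by
        intro T' hv hd hT'
        have e1 : avg (dir F' G')
            (fun y => (QueryTree.node Q pos neg).val y * (μ ^ ℓ * charSum a y)) z =
            avg (dir F' G') (fun y => T'.val y * (μ ^ ℓ * charSum a y)) z :=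
          avg_congr fun k hk => by rw [hv _ (chi_mul_of_mem_dir_insert (hdir hk) z)]
        have e2 : avg (dir F' G') (fun y => β ^ (QueryTree.node Q pos neg).depthAt y) z =
            β * avg (dir F' G') (fun y => β ^ T'.depthAt y) z := by
          rw [← avg_mul_left]
          exact avg_congr fun k hk => by
            rw [hd _ (chi_mul_of_mem_dir_insert (hdir hk) z), pow_succ']
        rw [e1, e2]
        refine hT'.trans_eq ?_
        ring
      -- The children run with threshold `t * β`; the extra β becomes the parent's additional unit
      -- of depth.
      by_cases hz : chi Q z = 1
      · refine aux pos (fun y hy => ?_) (fun y hy => ?_) (ihp F' G' hc' (mul_pos ht hβ) z)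
        · rw [QueryTree.val_node, if_pos (hy.trans hz)]
        · rw [QueryTree.depthAt, if_pos (hy.trans hz)]
      · refine aux neg (fun y hy => ?_) (fun y hy => ?_) (ihn F' G' hc' (mul_pos ht hβ) z)
        · rw [QueryTree.val_node, if_neg (hy ▸ hz)]
        · rw [QueryTree.depthAt, if_neg (hy ▸ hz)]
    rw [← avg_tower hle]
    refine (avg_mono (ψ := fun z =>
      t * avg (dir F' G') (fun y => β ^ (QueryTree.node Q pos neg).depthAt y) z +
        t * β / (t * β) ^ (2 * q) * γ ^ (2 * q * ℓ * G'.card) *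
          potential a μ (2 * q) F' z) fun k _ => hchild (x * k)).trans ?_
    rw [avg_add, avg_mul_left, avg_mul_left, avg_tower hle]
    refine add_le_add le_rfl ?_
    have hΨ := avg_potential_le (fun V hV => ha V hV.ne') μ hq hc hFF' x
    rw [← hγ] at hΨ
    have hΨ0 := potential_nonneg a μ q F x
    -- The clean-up budget: the query raises |F| + 2qℓ|G| by at most 2qℓ.
    have hexp : 2 * q * ℓ * G'.card + (F'.card - F.card) ≤
        2 * q * ℓ * G.card + 2 * q * ℓ := by
      have h1 := Nat.mul_le_mul_left (2 * q * ℓ) (card_insert_le Q G)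
      rw [mul_add, mul_one] at h1
      have h2 := card_le_card hFF'
      omega
    have hβq : (t * β) ^ (2 * q) = t ^ (2 * q) * (β ^ (2 * q - 1) * β) := by
      rw [mul_pow, ← pow_succ, Nat.sub_add_cancel (by omega)]
    have hγ0 : 0 < γ := by linarith
    -- Raising the threshold gains β^(2q-1), which pays for the γ^(2qℓ) of the query.
    have hcoef : t * β / (t * β) ^ (2 * q) ≤ t / t ^ (2 * q) / γ ^ (2 * q * ℓ) := by
      have : t * β / (t * β) ^ (2 * q) = t / t ^ (2 * q) / β ^ (2 * q - 1) := by
        rw [hβq]; field_simp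
      rw [this]
      gcongr
    calc _ ≤ t * β / (t * β) ^ (2 * q) * γ ^ (2 * q * ℓ * G'.card) *
          (γ ^ (F'.card - F.card) * potential a μ (2 * q) F x) := by gcongr
      _ = t * β / (t * β) ^ (2 * q) * (γ ^ (2 * q * ℓ * G'.card + (F'.card - F.card)) *
          potential a μ (2 * q) F x) := by rw [pow_add]; ring
      _ ≤ t / t ^ (2 * q) / γ ^ (2 * q * ℓ) * (γ ^ (2 * q * ℓ * G.card + 2 * q * ℓ) *
          potential a μ (2 * q) F x) := by gcongr
      _ = _ := by rw [pow_add]; field_simp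

/-! ### Exponential moments of the depth -/

lemma half_rpow_add_le {c u v : ℝ} (hc0 : 0 ≤ c) (hc1 : c ≤ 1) (hu : 0 ≤ u) (hv : 0 ≤ v) :
    (2 : ℝ) ^ c * ((1 / 2) * (u ^ c + v ^ c)) ≤ (u + v) ^ c := by
  have h := (Real.concaveOn_rpow hc0 hc1).2 (Set.mem_Ici.2 hu) (Set.mem_Ici.2 hv)
    (by norm_num : (0 : ℝ) ≤ 1 / 2) (by norm_num : (0 : ℝ) ≤ 1 / 2) (by norm_num)
  simp only [smul_eq_mul] at h
  calc (2 : ℝ) ^ c * ((1 / 2) * (u ^ c + v ^ c)) ≤ 2 ^ c * ((1 / 2) * u + (1 / 2) * v) ^ c := by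
        refine mul_le_mul_of_nonneg_left ?_ (by positivity)
        linarith
    _ = (u + v) ^ c := by
        rw [← Real.mul_rpow (by norm_num) (by positivity)]
        congr 1; ring

/-- The number of queries made on a random input has small exponential moments. -/
lemma avg_pow_depthAt_le {c : ℝ} (hc0 : 0 ≤ c) (hc1 : c ≤ 1) (T : QueryTree n)
    (A : Set (Finset (Fin n))) (hT : T.ValidBelow A) (x : Cube n) :
    avg (ann A) (fun y => ((2 : ℝ) ^ c) ^ T.depthAt y) x ≤ (T.size : ℝ) ^ c := by
  induction T generalizing A x with
  | leaf b => exact (avg_const fun _ _ => by simp [QueryTree.depthAt, QueryTree.size]).le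
  | node Q pos neg ihp ihn =>
    obtain ⟨-, hQ, hp, hn⟩ := hT
    unfold Implied at hQ
    push Not at hQ
    -- The direction `y * z⁻¹` keeps all earlier answers and flips that of `Q`, so the new answer is
    -- a fair bit.
    obtain ⟨y, z, hyz, hne⟩ := hQ
    have hinv : ∀ S : Finset (Fin n), chi S z⁻¹ = chi S z := fun S => by
      have h1 := chi_mul S z z⁻¹
      rw [mul_inv_cancel, chi_one] at h1
      rw [eq_comm, mul_eq_one_iff_eq_inv] at h1
      rw [h1, Int.units_inv_eq_self]
    have hk : y * z⁻¹ ∈ ann A := fun R hR => by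
      rw [chi_mul, hinv, hyz R hR, chi_mul_self]
    have hkQ : chi Q (y * z⁻¹) = -1 := by
      refine (Int.units_eq_one_or _).resolve_left fun h => hne ?_
      rw [chi_mul, hinv] at h
      rw [mul_eq_one_iff_eq_inv.1 h, Int.units_inv_eq_self]
    have hle : ann (insert Q A) ≤ ann A := ann_anti (Set.subset_insert Q A)
    set b : ℝ := 2 ^ c with hb
    have hb0 : 0 < b := by positivity
    set ψ : Cube n → ℝ := fun w =>
      b * (if chi Q w = 1 then (pos.size : ℝ) ^ c else (neg.size : ℝ) ^ c) with hψ
    have hchild : ∀ w : Cube n,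
        avg (ann (insert Q A)) (fun y => b ^ (QueryTree.node Q pos neg).depthAt y) w ≤ ψ w := by
      intro w
      have hQk : ∀ k ∈ ann (insert Q A), chi Q (w * k) = chi Q w := fun k hk => by
        rw [chi_mul, hk Q (Set.mem_insert Q A), mul_one]
      by_cases hw : chi Q w = 1
      · simp only [hψ, if_pos hw]
        refine le_trans (le_of_eq ?_) (mul_le_mul_of_nonneg_left (ihp _ hp w) hb0.le)
        rw [← avg_mul_left]
        exact avg_congr fun k hk => by
          rw [QueryTree.depthAt, if_pos ((hQk k hk).trans hw), pow_succ']
      · simp only [hψ, if_neg hw]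
        refine le_trans (le_of_eq ?_) (mul_le_mul_of_nonneg_left (ihn _ hn w) hb0.le)
        rw [← avg_mul_left]
        exact avg_congr fun k hk => by
          rw [QueryTree.depthAt, if_neg (hQk k hk ▸ hw), pow_succ']
    rw [← avg_tower hle]
    refine (avg_mono fun k _ => hchild (x * k)).trans ?_
    rw [avg_pair hk]
    have hconst : avg (ann A) (fun w => (1 / 2) * (ψ w + ψ (w * (y * z⁻¹)))) x =
        b * ((1 / 2) * ((pos.size : ℝ) ^ c + (neg.size : ℝ) ^ c)) := by
      refine avg_const fun k _ => ?_
      simp only [hψ, chi_mul Q (x * k) (y * z⁻¹), hkQ]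
      rcases Int.units_eq_one_or (chi Q (x * k)) with h | h <;> rw [h] <;> simp <;> ring
    rw [hconst]
    refine (half_rpow_add_le hc0 hc1 (Nat.cast_nonneg _) (Nat.cast_nonneg _)).trans ?_
    refine Real.rpow_le_rpow (by positivity) ?_ hc0
    rw [QueryTree.size]
    push_cast
    linarith

/-! ### Choice of parameters -/

lemma potential_empty_le {a : Finset (Fin n) → ℝ} {ℓ : ℕ} (ha : ∀ V, V.card ≠ ℓ → a V = 0)
    (ha1 : ∀ V, |a V| ≤ 1) (μ : ℝ) {q : ℕ} (hq : 1 ≤ q) (x : Cube n) :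
    potential a μ (2 * q) ∅ x ≤ (n : ℝ) ^ ℓ := by
  have h1 : ∀ S, walk a μ ∅ S x ^ (2 * q) ≤ if S ∈ powersetCard ℓ univ then 1 else 0 := by
    intro S
    have e : walk a μ ∅ S x = a S := by simp [walk, chiR_empty]
    rw [e]
    split_ifs with h
    · rw [← (even_two_mul q).pow_abs]
      exact pow_le_one₀ (abs_nonneg _) (ha1 S)
    · rw [ha S fun h' => h (mem_powersetCard.2 ⟨subset_univ S, h'⟩)]
      rw [zero_pow (by omega)]
  refine (sum_le_sum fun S _ => h1 S).trans ?_
  rw [sum_ite_mem, univ_inter, sum_const, card_powersetCard, card_univ, Fintype.card_fin,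
    nsmul_one]
  exact_mod_cast Nat.choose_le_pow n ℓ

lemma levelL1_val (T : QueryTree n) (ℓ : ℕ) :
    ∃ a : Finset (Fin n) → ℝ, (∀ V, V.card ≠ ℓ → a V = 0) ∧ (∀ V, |a V| ≤ 1) ∧
      levelL1 ℓ T.val = avg ⊤ (fun y => T.val y * charSum a y) 1 := by
  refine ⟨fun V => if V.card = ℓ then SignType.sign (fourierCoeff T.val V) else 0,
    fun V hV => by simp [hV], fun V => ?_, ?_⟩
  · dsimp only
    split_ifs
    · rcases lt_trichotomy (fourierCoeff T.val V) 0 with h | h | h <;> simp [h]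
    · simp
  · rw [avg_top_one]
    simp only [charSum, mul_sum]
    rw [sum_comm, sum_div, levelL1, ← powerset_univ, powersetCard_eq_filter, sum_filter]
    refine sum_congr rfl fun V _ => ?_
    split_ifs with h
    · rw [← sign_mul_self, fourierCoeff, ← mul_div_assoc, mul_sum]
      congr 1
      refine sum_congr rfl fun x _ => ?_
      rw [chiR]; ring
    · simp

/-- Leaves are treated apart: they allow s < 2, where log₂ s < 1 and `levelL1_le` does not apply. -/
lemma levelL1_leaf {ℓ : ℕ} (hℓ : 1 ≤ ℓ) (b : Bool) :
    levelL1 ℓ (QueryTree.leaf b : QueryTree n).val = 0 := by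
  obtain ⟨a, ha, -, h⟩ := levelL1_val (QueryTree.leaf b : QueryTree n) ℓ
  have h0 := avg_charSum ha le_rfl 1 (clean_empty ℓ ∅) 1
  have hw : walk a 1 ∅ ∅ 1 = 0 := by
    simp [walk, ha ∅ (by rw [card_empty]; omega)]
  rw [dir_empty, hw] at h0
  simp only [one_pow, one_mul] at h0
  rw [h]
  have : avg ⊤ (fun y => (QueryTree.leaf b : QueryTree n).val y * charSum a y) 1 =
      (if b then 1 else 0) * avg ⊤ (fun y => charSum a y) 1 := by
    rw [← avg_mul_left]; rfl
  rw [this, h0, mul_zero]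

/-- The Fourier growth bound with a free moment parameter `q`. -/
theorem levelL1_le {T : QueryTree n} (hT : T.ValidBelow ∅) {s : ℝ} (hs : 2 ≤ s)
    (hTs : (T.size : ℝ) ≤ s) {ℓ q : ℕ} (hℓ : 1 ≤ ℓ) (hq : 1 ≤ q) (hn : n ≤ 2 ^ q) :
    levelL1 ℓ T.val ≤ 3 * (2 * (2 * q * √(ℓ * Real.logb 2 s))) ^ ℓ := by
  set L := Real.logb 2 s with hL
  have hL1 : 1 ≤ L := by
    rw [hL, Real.le_logb_iff_rpow_le (by norm_num) (by linarith)]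
    simpa using hs
  have hℓ' : (1 : ℝ) ≤ ℓ := by exact_mod_cast hℓ
  have hq' : (1 : ℝ) ≤ q := by exact_mod_cast hq
  set M : ℝ := 2 * q * √(ℓ * L) with hM
  have hM0 : 0 < M := by positivity
  have hM2 : M ^ 2 = 4 * q ^ 2 * (ℓ * L) := by
    rw [hM, mul_pow, Real.sq_sqrt (by positivity)]; ring
  obtain ⟨a, ha, ha1, h⟩ := levelL1_val T ℓ
  set β : ℝ := 2 ^ (1 / L) with hβ
  have hβ0 : 0 < β := by positivity
  have hcast : ((2 * q - 1 : ℕ) : ℝ) = 2 * q - 1 := by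
    rw [Nat.cast_sub (by omega)]; push_cast; ring
  have hβγ : ((1 + (2 * q - 1) * (1 / M) ^ 2) ^ q) ^ (2 * q * ℓ) ≤ β ^ (2 * q - 1) := by
    have e1 : β ^ (2 * q - 1) = Real.exp (Real.log 2 * (1 / L) * (2 * q - 1)) := by
      rw [← Real.rpow_natCast, hcast, hβ, ← Real.rpow_mul (by norm_num),
        Real.rpow_def_of_pos (by norm_num), mul_assoc]
    have e2 : 1 + (2 * q - 1) * (1 / M) ^ 2 ≤ Real.exp ((2 * q - 1) * (1 / M) ^ 2) := by
      rw [add_comm]; exact Real.add_one_le_exp _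
    have e3 : 0 ≤ 1 + (2 * (q : ℝ) - 1) * (1 / M) ^ 2 := by
      have : 0 ≤ (2 * (q : ℝ) - 1) * (1 / M) ^ 2 := mul_nonneg (by linarith) (sq_nonneg _)
      linarith
    rw [e1, ← pow_mul]
    refine (pow_le_pow_left₀ e3 e2 _).trans ?_
    rw [← Real.exp_nat_mul, Real.exp_le_exp]
    -- `M` is chosen for this identity; the factor 1/2 is then at most log 2.
    have e4 : ((q * (2 * q * ℓ) : ℕ) : ℝ) * ((2 * q - 1) * (1 / M) ^ 2) =
        (1 / 2) * ((1 / L) * (2 * q - 1)) := by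
      rw [one_div_pow, hM2]; push_cast; field_simp; ring
    rw [e4, mul_assoc]
    have e5 : (1 / 2 : ℝ) ≤ Real.log 2 := by linarith [Real.log_two_gt_d9]
    have e6 : 0 ≤ (1 / L) * (2 * (q : ℝ) - 1) := mul_nonneg (by positivity) (by linarith)
    exact mul_le_mul_of_nonneg_right e5 e6
  have main := avg_val_mul_charSum_le ha hq hβ0 rfl hβγ T ∅ ∅ (clean_empty _ _)
    (by positivity : (0 : ℝ) < 2 ^ ℓ) 1
  have hdepth := avg_pow_depthAt_le (c := 1 / L) (by positivity) (by
    rw [div_le_one (by linarith)]; exact hL1) T ∅ hT 1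
  rw [ann_empty] at hdepth
  have hs2 : (T.size : ℝ) ^ (1 / L) ≤ 2 := by
    refine (Real.rpow_le_rpow (by positivity) hTs (by positivity)).trans_eq ?_
    have : s = 2 ^ L := (Real.rpow_logb (by norm_num) (by norm_num) (by linarith)).symm
    rw [this, ← Real.rpow_mul (by norm_num), mul_one_div_cancel (by linarith), Real.rpow_one]
  rw [dir_empty, card_empty, mul_zero, pow_zero, one_mul] at main
  have e0 : (fun y => T.val y * ((1 / M) ^ ℓ * charSum a y)) =
      fun y => (1 / M) ^ ℓ * (T.val y * charSum a y) := by ext y; ring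
  rw [e0, avg_mul_left, ← h] at main
  -- With t = 2^ℓ, the initial potential is at most n^ℓ ≤ 2^(qℓ) ≤ t^(2q).
  have hpot : (2 : ℝ) ^ ℓ / (2 ^ ℓ) ^ (2 * q) * potential a (1 / M) (2 * q) ∅ 1 ≤ 2 ^ ℓ := by
    rw [div_mul_eq_mul_div, div_le_iff₀ (by positivity)]
    refine mul_le_mul_of_nonneg_left ((potential_empty_le ha ha1 _ hq _).trans ?_) (by positivity)
    have hn' : (n : ℝ) ≤ 2 ^ q := by exact_mod_cast hn
    refine (pow_le_pow_left₀ (by positivity) hn' ℓ).trans ?_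
    rw [← pow_mul, ← pow_mul]
    refine pow_le_pow_right₀ (by norm_num) ?_
    nlinarith [Nat.zero_le (q * ℓ)]
  have hfin : (1 / M) ^ ℓ * levelL1 ℓ T.val ≤ 3 * 2 ^ ℓ := by
    have := mul_le_mul_of_nonneg_left (hdepth.trans hs2) (by positivity : (0 : ℝ) ≤ 2 ^ ℓ)
    linarith
  rw [one_div_pow, one_div_mul_eq_div, div_le_iff₀ (by positivity)] at hfin
  rw [mul_pow]
  linarith

end PDT

theorem corollary1p8 :
    ∃ C : ℝ, 0 < C ∧
      ∀ (n : ℕ), 2 ≤ n →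
      ∀ (s : ℝ), 1 < s →
      ∀ (T : PDT.ParityDecisionTree n), (T.size : ℝ) ≤ s →
      ∀ (ℓ : ℕ), 1 ≤ ℓ → ℓ ≤ n →
        PDT.levelL1 ℓ T.toFun ≤
          (Real.logb 2 s) ^ ((ℓ : ℝ) / 2) *
            (C * ((ℓ : ℝ) * Real.logb 2 (n : ℝ))) ^ ((3 / 2 : ℝ) * (ℓ : ℝ)) := by
  -- 24 = 3 · 4 · 2: the prefactor 3 ≤ 3^ℓ, the 4q in `levelL1_le`, and q ≤ 2 log₂ n.
  refine ⟨24, by norm_num, fun n hn s hs T hTs ℓ hℓ _ => ?_⟩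
  have hfun : T.toFun = T.tree.val := rfl
  have hn' : (2 : ℝ) ≤ n := by exact_mod_cast hn
  have hℓ' : (1 : ℝ) ≤ ℓ := by exact_mod_cast hℓ
  have hN : 1 ≤ Real.logb 2 n := by
    rw [Real.le_logb_iff_rpow_le (by norm_num) (by linarith)]
    simpa using hn'
  have hL0 : 0 < Real.logb 2 s := Real.logb_pos (by norm_num) hs
  rw [hfun]
  cases htree : T.tree with
  | leaf b =>
    rw [PDT.levelL1_leaf hℓ]
    positivity
  | node Q pos neg =>
    rw [← htree]
    have hs2 : 2 ≤ s := by
      refine le_trans ?_ hTs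
      have h1 : 2 ≤ T.size := by
        rw [PDT.ParityDecisionTree.size, htree, PDT.QueryTree.size]
        have := pos.size_pos
        omega
      exact_mod_cast h1
    have hq1 : 1 ≤ Nat.clog 2 n := Nat.clog_pos (by norm_num) hn
    have hb := PDT.levelL1_le T.valid hs2 hTs hℓ hq1 (Nat.le_pow_clog (by norm_num) n)
    set q := Nat.clog 2 n
    set L := Real.logb 2 s
    set N := Real.logb 2 (n : ℝ) with hNdef
    have hq2 : (q : ℝ) ≤ 2 * N := by
      have h1 : 2 ^ (q - 1) < n := Nat.pow_pred_clog_lt_self (by norm_num) hn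
      have h2 : ((q - 1 : ℕ) : ℝ) ≤ N := by
        rw [hNdef, Real.le_logb_iff_rpow_le (by norm_num) (by linarith), Real.rpow_natCast]
        exact_mod_cast h1.le
      rw [Nat.cast_sub hq1] at h2
      push_cast at h2
      linarith
    refine hb.trans ?_
    have e1 : √((ℓ : ℝ) * L) ^ ℓ = (ℓ : ℝ) ^ ((ℓ : ℝ) / 2) * L ^ ((ℓ : ℝ) / 2) := by
      rw [← Real.rpow_natCast, Real.sqrt_eq_rpow, ← Real.rpow_mul (by positivity),
        Real.mul_rpow (by positivity) hL0.le]
      congr 2 <;> ring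
    have e2 : (24 * ((ℓ : ℝ) * N)) ^ ((3 / 2 : ℝ) * (ℓ : ℝ)) =
        (24 * ((ℓ : ℝ) * N)) ^ ℓ * (24 * ((ℓ : ℝ) * N)) ^ ((ℓ : ℝ) / 2) := by
      rw [← Real.rpow_natCast, ← Real.rpow_add (by positivity)]
      congr 1; ring
    have e3 : (3 : ℝ) ≤ 3 ^ ℓ := le_self_pow₀ (by norm_num) (by omega)
    -- The half power only has to cover ℓ^(ℓ/2); its factor (log₂ n)^(ℓ/2) is slack.
    have e4 : (ℓ : ℝ) ≤ 24 * (ℓ * N) := by nlinarith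
    have e5 : 12 * (q : ℝ) ≤ 24 * (ℓ * N) := by nlinarith
    calc 3 * (2 * (2 * q * √((ℓ : ℝ) * L))) ^ ℓ
        ≤ 3 ^ ℓ * (2 * (2 * q * √((ℓ : ℝ) * L))) ^ ℓ := by gcongr
      _ = L ^ ((ℓ : ℝ) / 2) * ((12 * q) ^ ℓ * (ℓ : ℝ) ^ ((ℓ : ℝ) / 2)) := by
        rw [← mul_pow, show 3 * (2 * (2 * q * √((ℓ : ℝ) * L))) = 12 * q * √((ℓ : ℝ) * L) by ring,
          mul_pow _ (√((ℓ : ℝ) * L)), e1]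
        ring
      _ ≤ L ^ ((ℓ : ℝ) / 2) * ((24 * (ℓ * N)) ^ ℓ * (24 * (ℓ * N)) ^ ((ℓ : ℝ) / 2)) := by
        gcongr
      _ = _ := by rw [e2]
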